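/- Let $\kappa\ge 1$ and $n=2^{\kappa-1}$, and put $k=n-\kappa$. A binary $(n,\kappa)$ coset code consists of a $\kappa\times n$ generator matrix $G$ over $\mathbb{F}_2$ and a $k\times n$ auxiliary matrix $G'$ such that the $n$ rows of $G'$ and $G$ together are linearly independent. A uniformly distributed message $M\in\mathbb{F}_2^k$ is encoded as $X=\begin{bmatrix} M & M'\end{bmatrix}\begin{bmatrix} G'\\ G\end{bmatrix}$ with $M'\in\mathbb{F}_2^\kappa$ uniform and independent of $M$, and the eavesdropper observes the output $Z\in\{0,1,?\}^n$ of the memoryless binary erasure channel with erasure probability $\epsilon$ and input $X$. Let $$\lambda=\sum_{m,z}\left(\frac{p_{MZ}(m,z)}{p_M(m)\,p_Z(z)}-1\right)^2p_M(m)\,p_Z(z)$$ be the $\chi^2$ divergence between the joint distribution of $(M,Z)$ and the product of its marginals, where terms with $p_Z(z)=0$ count as $0$. The code is an augmented Hadamard code if, for some $(\kappa-1)$-dimensional subspace $U$ of $\mathbb{F}_2^\kappa$, the columns of $G$ contain all vectors outside $U$ in equal proportion $1/(2^\kappa-2^{\kappa-1})$ (that is, each exactly once), and no vector of $U$. Then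 augmented Hadamard codes are optimal for their size: for every $\epsilon\in[0,1]$, the $\chi^2$ divergence $\lambda$ of an augmented Hadamard coset code is at most that of every $(n,\kappa)$ coset code; and the probability that an eavesdropper who uses maximum likelihood decoding (choosing, for each $z$, a message $m$ that maximizes $p(z\mid m)$) correctly recovers $M$ is for an augmented Hadamard coset code at most what it is for every $(n,\kappa)$ coset code. -/

import Mathlib

open scoped Matrix

noncomputable section

/-- The `χ²` divergence `∑ₐ (p(a)/q(a) - 1)² q(a)` between two mass functions on a finite alphabet
(letters with `q(a) = 0` contribute `0`). -/
def chiSquared {α : Type*} [Fintype α] (p q : α → ℝ) : ℝ :=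
  ∑ a, (p a / q a - 1) ^ 2 * q a

/-- Transition probabilities of the binary erasure channel with erasure probability `ε`;
`none` is the erasure symbol `?`. -/
def becTransition (ε : ℝ) (x : ZMod 2) : Option (ZMod 2) → ℝ
  | none => ε
  | some y => if y = x then 1 - ε else 0

/-- The memoryless extension of the binary erasure channel to words of length `n`. -/
def becWord {n : ℕ} (ε : ℝ) (x : Fin n → ZMod 2) (z : Fin n → Option (ZMod 2)) : ℝ :=
  ∏ i, becTransition ε (x i) (z i)

/-- A binary coset code with `k`-bit messages, base code of dimension `κ` and blocklength
`n = k + κ`: a `κ × n` generator matrix `G` of the base code and a `k × n` auxiliary generator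
matrix `G'`, such that the rows of `G'` and `G` together are linearly independent. -/
structure CosetCode (k κ : ℕ) where
  /-- generator matrix of the base code -/
  G : Matrix (Fin κ) (Fin (k + κ)) (ZMod 2)
  /-- auxiliary generator matrix, which selects the coset -/
  G' : Matrix (Fin k) (Fin (k + κ)) (ZMod 2)
  linearIndependent_rows : LinearIndependent (ZMod 2) (Matrix.fromRows G' G).row

/-- The code definition vector: `q v` is the fraction of the columns of `G` equal to `v`. -/
def codeDefinitionVector {κ n : ℕ} (G : Matrix (Fin κ) (Fin n) (ZMod 2))
    (v : Fin κ → ZMod 2) : ℝ :=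
  ((Finset.univ.filter fun j => G.col j = v).card : ℝ) / n

open Classical in
/-- The code definition vector of the subspace exclusion code that excludes `U`: all columns
outside of `U` in equal proportion, no column in `U`. -/
def subspaceExclusionVector {κ : ℕ} (U : Submodule (ZMod 2) (Fin κ → ZMod 2))
    (v : Fin κ → ZMod 2) : ℝ :=
  if v ∈ U then 0 else 1 / (2 ^ κ - 2 ^ Module.finrank (ZMod 2) U)

namespace CosetCode

variable {k κ : ℕ}

/-- The codeword `[m m'] [G'; G]` of the message `m` and the auxiliary message `m'`. -/
def codeword (C : CosetCode k κ) (m : Fin k → ZMod 2) (m' : Fin κ → ZMod 2) :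
    Fin (k + κ) → ZMod 2 :=
  Sum.elim m m' ᵥ* Matrix.fromRows C.G' C.G

/-- The conditional probability `p(z | m)` that the eavesdropper observes `z` when the message is
`m`; the auxiliary message is uniformly distributed. -/
def likelihood (C : CosetCode k κ) (ε : ℝ) (m : Fin k → ZMod 2)
    (z : Fin (k + κ) → Option (ZMod 2)) : ℝ :=
  ∑ m' : Fin κ → ZMod 2, (1 / 2 ^ κ) * becWord ε (C.codeword m m') z

/-- The distribution of the message, which is uniform on `k`-bit words. -/
def pM (_C : CosetCode k κ) (_m : Fin k → ZMod 2) : ℝ := 1 / 2 ^ k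

/-- The joint distribution of the message and the eavesdropper's observation. -/
def pMZ (C : CosetCode k κ) (ε : ℝ) (m : Fin k → ZMod 2)
    (z : Fin (k + κ) → Option (ZMod 2)) : ℝ :=
  C.pM m * C.likelihood ε m z

/-- The marginal distribution of the eavesdropper's observation. -/
def pZ (C : CosetCode k κ) (ε : ℝ) (z : Fin (k + κ) → Option (ZMod 2)) : ℝ :=
  ∑ m, C.pMZ ε m z

/-- The `χ²` divergence between the joint distribution of the message and the eavesdropper's
observation, and the product of its marginals, at erasure probability `ε`. -/
def chiSquaredLeakage (C : CosetCode k κ) (ε : ℝ) : ℝ :=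
  chiSquared
    (fun a : (Fin k → ZMod 2) × (Fin (k + κ) → Option (ZMod 2)) => C.pMZ ε a.1 a.2)
    (fun a => C.pM a.1 * C.pZ ε a.2)

/-- `g` is a maximum likelihood decoder for the eavesdropper: for each observation it returns
a message of maximal likelihood. -/
def IsMLDecoder (C : CosetCode k κ) (ε : ℝ)
    (g : (Fin (k + κ) → Option (ZMod 2)) → Fin k → ZMod 2) : Prop :=
  ∀ z m, C.likelihood ε m z ≤ C.likelihood ε (g z) z

/-- The probability `Pr[g(Z) = M]` that the decoder `g` returns the message that was sent. -/
def successProbability (C : CosetCode k κ) (ε : ℝ)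
    (g : (Fin (k + κ) → Option (ZMod 2)) → Fin k → ZMod 2) : ℝ :=
  ∑ z, C.pMZ ε (g z) z

/-- The base code is an augmented Hadamard code: the blocklength is `2 ^ (κ - 1)`, and the code is
a subspace exclusion code excluding a subspace of dimension `κ - 1`. -/
def IsAugmentedHadamard (C : CosetCode k κ) : Prop :=
  k + κ = 2 ^ (κ - 1) ∧
    ∃ U : Submodule (ZMod 2) (Fin κ → ZMod 2), Module.finrank (ZMod 2) U + 1 = κ ∧
      codeDefinitionVector C.G = subspaceExclusionVector U

end CosetCode

end

/-! Given `z`, every message has likelihood zero or one common peak value, because cosets are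
translates of the base code. Hence the leakage and the success probability are increasing affine
functions of the sum of peaks over `z`, which is a multiple of `dualEnumerator` and depends only on
`G`. For `ε > 0` this is a positive constant times `∑ exp (θ f)`, with `f` the imbalances and `θ ≥
0`. The bound is of linear programming type. A quadratic minorant of `exp (θ f)`, exact at `0` and
`-n`, is summed over the nonzero `m`, with first and second moments bounded by character
orthogonality. A Hadamard code attains equality: its nonzero words have imbalance `0`, except one
with `-n`. -/

section ExponentialBounds

lemma exp_neg_le_quadratic {y : ℝ} (hy : 0 ≤ y) : Real.exp (-y) ≤ 1 - y + y ^ 2 / 2 := by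
  have hd : ∀ x : ℝ, HasDerivAt (fun x : ℝ => 1 - x + x ^ 2 / 2 - Real.exp (-x))
      (-1 + x + Real.exp (-x)) x := by
    intro x
    have h := ((((hasDerivAt_const x (1 : ℝ)).sub (hasDerivAt_id x)).add
      (((hasDerivAt_id x).pow 2).div_const 2)).sub (hasDerivAt_neg x).exp)
    refine HasDerivAt.congr_deriv (h : HasDerivAt (fun x : ℝ => 1 - x + x ^ 2 / 2 - Real.exp (-x))
      _ x) ?_
    simp
  have hm : Monotone fun x : ℝ => 1 - x + x ^ 2 / 2 - Real.exp (-x) := by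
    refine monotone_of_deriv_nonneg (fun x => (hd x).differentiableAt) fun x => ?_
    rw [(hd x).deriv]
    linarith [Real.add_one_le_exp (-x)]
  have := hm hy
  simp only [neg_zero, Real.exp_zero] at this
  linarith

lemma sq_mul_exp_neg_sub_le {t y : ℝ} (ht0 : 0 ≤ t) (ht1 : t ≤ 1) (hy : 0 ≤ y) :
    t ^ 2 * (Real.exp (-y) - 1 + y) ≤ Real.exp (-(t * y)) - 1 + t * y := by
  have hd : ∀ x : ℝ, HasDerivAt
      (fun x : ℝ => Real.exp (-(t * x)) - 1 + t * x - t ^ 2 * (Real.exp (-x) - 1 + x))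
      (t * (1 - Real.exp (-(t * x)) - t * (1 - Real.exp (-x)))) x := by
    intro x
    have h1 : HasDerivAt (fun x : ℝ => t * x) t x := by
      simpa using (hasDerivAt_id x).const_mul t
    have h := ((h1.neg.exp.sub_const 1).add h1).sub
      ((((hasDerivAt_neg x).exp.sub_const 1).add (hasDerivAt_id x)).const_mul (t ^ 2))
    refine HasDerivAt.congr_deriv (h : HasDerivAt
      (fun x : ℝ => Real.exp (-(t * x)) - 1 + t * x - t ^ 2 * (Real.exp (-x) - 1 + x)) _ x) ?_
    simp
    ring
  have hm : MonotoneOn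
      (fun x : ℝ => Real.exp (-(t * x)) - 1 + t * x - t ^ 2 * (Real.exp (-x) - 1 + x))
      (Set.Ici 0) := by
    refine monotoneOn_of_deriv_nonneg (convex_Ici 0)
      (fun x _ => (hd x).continuousAt.continuousWithinAt)
      (fun x _ => (hd x).differentiableAt.differentiableWithinAt) fun x _ => ?_
    rw [(hd x).deriv]
    refine mul_nonneg ht0 ?_
    -- Convexity between `-x` and `0` gives `exp (-(t x)) ≤ t exp (-x) + 1 - t`.
    have h := convexOn_exp.2 (Set.mem_univ (-x)) (Set.mem_univ 0) ht0 (sub_nonneg.2 ht1)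
      (by ring)
    simp only [smul_eq_mul, mul_zero, add_zero, Real.exp_zero, mul_one, mul_neg] at h
    linarith
  have := hm Set.self_mem_Ici (Set.mem_Ici.2 hy) hy
  simp only [mul_zero, neg_zero, Real.exp_zero] at this
  linarith

/-- Monotonicity of `(exp x - 1 - x) / x ^ 2`, cleared of denominators. For `x ≥ 0` the value `1 /
2` separates the two sides; for `x ≤ 0`, scale by `t = -x / y`. -/
lemma exp_sub_linear_ratio_le {x y : ℝ} (hy : 0 ≤ y) (hxy : -y ≤ x) :
    (Real.exp (-y) - 1 + y) * x ^ 2 ≤ (Real.exp x - 1 - x) * y ^ 2 := by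
  rcases le_total 0 x with hx | hx
  · nlinarith [exp_neg_le_quadratic hy, Real.quadratic_le_exp_of_nonneg hx,
      mul_le_mul_of_nonneg_right (exp_neg_le_quadratic hy) (sq_nonneg x),
      mul_le_mul_of_nonneg_right (Real.quadratic_le_exp_of_nonneg hx) (sq_nonneg y)]
  · rcases hy.eq_or_lt with rfl | hy'
    · simp
    have h := sq_mul_exp_neg_sub_le (t := -x / y) (by apply div_nonneg <;> linarith)
      ((div_le_one hy').2 (by linarith)) hy
    rw [div_mul_cancel₀ _ hy'.ne', neg_neg, div_pow, neg_sq, div_mul_eq_mul_div,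
      div_le_iff₀ (by positivity)] at h
    linarith

/-- A quadratic minorant of `exp (θ f)` on `[-n, ∞)`, which touches at `0` and `-n`. -/
lemma quadratic_le_exp_mul {θ n f : ℝ} (hθ : 0 ≤ θ) (hn : 0 < n) (hf : -n ≤ f) :
    1 + θ * f + (Real.exp (-(θ * n)) - 1 + θ * n) / n ^ 2 * f ^ 2 ≤ Real.exp (θ * f) := by
  rcases hθ.eq_or_lt with rfl | hθ'
  · simp
  have h := exp_sub_linear_ratio_le (x := θ * f) (y := θ * n) (by positivity) (by nlinarith)
  have h2 : (Real.exp (-(θ * n)) - 1 + θ * n) * f ^ 2 ≤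
      (Real.exp (θ * f) - 1 - θ * f) * n ^ 2 := by
    refine le_of_mul_le_mul_left ?_ (pow_pos hθ' 2)
    linarith
  rw [div_mul_eq_mul_div]
  have := (div_le_iff₀ (pow_pos hn 2)).2 h2
  linarith

end ExponentialBounds

/-! ### Imbalances of codewords and their moments -/

section Characters

/-- The nontrivial character of `ZMod 2`. -/
def bitSign (a : ZMod 2) : ℝ := if a = 0 then 1 else -1

lemma bitSign_zero : bitSign 0 = 1 := if_pos rfl

lemma bitSign_one : bitSign 1 = -1 := if_neg one_ne_zero

lemma bitSign_add (a b : ZMod 2) : bitSign (a + b) = bitSign a * bitSign b := by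
  have hz : ∀ c : ZMod 2, c = 0 ∨ c = 1 := by decide
  rcases hz a with rfl | rfl <;> rcases hz b with rfl | rfl <;>
    simp [bitSign, CharTwo.add_self_eq_zero]

lemma neg_one_le_bitSign (a : ZMod 2) : -1 ≤ bitSign a := by
  unfold bitSign; split_ifs <;> norm_num

variable {κ n : ℕ}

lemma sum_bitSign_dotProduct (v : Fin κ → ZMod 2) :
    ∑ m : Fin κ → ZMod 2, bitSign (m ⬝ᵥ v) = if v = 0 then 2 ^ κ else 0 := by
  split_ifs with hv
  · simp [hv, bitSign_zero]
  · obtain ⟨i, hi⟩ := Function.ne_iff.1 hv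
    have hi1 : v i = 1 := (by decide : ∀ a : ZMod 2, a ≠ 0 → a = 1) _ hi
    -- Flipping bit `i` of `m` negates every term.
    have h := Equiv.sum_comp (Equiv.addRight (Pi.single i (1 : ZMod 2)))
      fun m : Fin κ → ZMod 2 => bitSign (m ⬝ᵥ v)
    simp only [Equiv.coe_addRight, add_dotProduct, single_dotProduct, hi1, bitSign_add, mul_one,
      bitSign_one, mul_neg, Finset.sum_neg_distrib] at h
    linarith

/-- The imbalance (number of zeros minus number of ones) of the codeword `m G`. -/
def imbalance (G : Matrix (Fin κ) (Fin n) (ZMod 2)) (m : Fin κ → ZMod 2) : ℝ :=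
  ∑ i, bitSign ((m ᵥ* G) i)

variable (G : Matrix (Fin κ) (Fin n) (ZMod 2))

lemma imbalance_zero : imbalance G 0 = n := by simp [imbalance, bitSign_zero]

lemma neg_le_imbalance (m : Fin κ → ZMod 2) : -(n : ℝ) ≤ imbalance G m := by
  have h : ∑ _i : Fin n, (-1 : ℝ) ≤ imbalance G m :=
    Finset.sum_le_sum fun i _ => neg_one_le_bitSign _
  simpa using h

lemma sum_imbalance :
    ∑ m, imbalance G m = ∑ i, if G.col i = 0 then (2 : ℝ) ^ κ else 0 := by
  simp only [imbalance]
  rw [Finset.sum_comm]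
  exact Finset.sum_congr rfl fun i _ => sum_bitSign_dotProduct (G.col i)

lemma sum_imbalance_sq :
    ∑ m, imbalance G m ^ 2 = ∑ i, ∑ j, if G.col i = G.col j then (2 : ℝ) ^ κ else 0 := by
  simp only [imbalance, sq, Finset.sum_mul_sum]
  rw [Finset.sum_comm]
  refine Finset.sum_congr rfl fun i _ => ?_
  rw [Finset.sum_comm]
  refine Finset.sum_congr rfl fun j _ => ?_
  have h : ∀ m : Fin κ → ZMod 2, bitSign ((m ᵥ* G) i) * bitSign ((m ᵥ* G) j) =
      bitSign (m ⬝ᵥ (G.col i + G.col j)) := fun m => by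
    rw [dotProduct_add, bitSign_add]; rfl
  simp only [h, sum_bitSign_dotProduct]
  refine if_congr ?_ rfl rfl
  simp only [funext_iff, Pi.add_apply, Pi.zero_apply, CharTwo.add_eq_zero]

lemma sum_imbalance_nonneg : 0 ≤ ∑ m, imbalance G m := by
  rw [sum_imbalance]
  positivity

/-- The diagonal pairs `i = j` alone give this; equality holds for distinct columns. -/
lemma le_sum_imbalance_sq : 2 ^ κ * (n : ℝ) ≤ ∑ m, imbalance G m ^ 2 := by
  rw [sum_imbalance_sq]
  have h : ∀ i, (2 : ℝ) ^ κ ≤ ∑ j, if G.col i = G.col j then (2 : ℝ) ^ κ else 0 := fun i => by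
    have := Finset.single_le_sum (f := fun j => if G.col i = G.col j then (2 : ℝ) ^ κ else 0)
      (fun j _ => by positivity) (Finset.mem_univ i)
    simpa using this
  have := Finset.sum_le_sum fun i (_ : i ∈ Finset.univ) => h i
  simpa [mul_comm] using this

variable {G}

lemma sum_imbalance_eq_zero (hG : ∀ i, G.col i ≠ 0) : ∑ m, imbalance G m = 0 := by
  rw [sum_imbalance]
  simp [hG]

lemma sum_imbalance_sq_eq (hG : Function.Injective G.col) :
    ∑ m, imbalance G m ^ 2 = 2 ^ κ * (n : ℝ) := by
  rw [sum_imbalance_sq]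
  simp [hG.eq_iff, mul_comm]

/-- For `2n = 2 ^ κ` distinct columns on an affine hyperplane, all codewords but `0` and one
other are balanced. -/
lemma imbalance_eq_zero (hn : (2 : ℝ) ^ κ = 2 * n) (hG : Function.Injective G.col)
    {u : Fin κ → ZMod 2} (hu0 : u ≠ 0) (hu : imbalance G u = -n)
    {m : Fin κ → ZMod 2} (hm0 : m ≠ 0) (hmu : m ≠ u) : imbalance G m = 0 := by
  have h := sum_imbalance_sq_eq hG
  rw [← Finset.add_sum_erase _ _ (Finset.mem_univ 0),
    ← Finset.add_sum_erase _ _ (Finset.mem_erase.2 ⟨hu0, Finset.mem_univ u⟩),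
    imbalance_zero, hu, hn] at h
  -- The words `0` and `u` already exhaust the second moment `2 n ^ 2`.
  have h0 : ∑ m ∈ (Finset.univ.erase 0).erase u, imbalance G m ^ 2 = 0 := by linarith
  rw [Finset.sum_eq_zero_iff_of_nonneg fun _ _ => sq_nonneg _] at h0
  exact pow_eq_zero_iff two_ne_zero |>.1 (h0 m (by simp [hm0, hmu]))

lemma sum_exp_imbalance_le {θ : ℝ} (hθ : 0 ≤ θ) (hn0 : 0 < n) (hn : (2 : ℝ) ^ κ = 2 * n)
    (hG : Function.Injective G.col) {u : Fin κ → ZMod 2} (hu : imbalance G u = -n)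
    (H : Matrix (Fin κ) (Fin n) (ZMod 2)) :
    ∑ m, Real.exp (θ * imbalance G m) ≤ ∑ m, Real.exp (θ * imbalance H m) := by
  have hn' : (0 : ℝ) < n := by exact_mod_cast hn0
  have hu0 : u ≠ 0 := by
    rintro rfl
    rw [imbalance_zero] at hu
    linarith
  set c := (Real.exp (-(θ * n)) - 1 + θ * n) / (n : ℝ) ^ 2 with hc
  have hc0 : 0 ≤ c := div_nonneg (by linarith [Real.add_one_le_exp (-(θ * n))]) (by positivity)
  have hcn : c * (n : ℝ) ^ 2 = Real.exp (-(θ * n)) - 1 + θ * n :=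
    div_mul_cancel₀ _ (by positivity)
  have hcard : ((Finset.univ.erase (0 : Fin κ → ZMod 2)).card : ℝ) = 2 * n - 1 := by
    rw [Finset.card_erase_of_mem (Finset.mem_univ _), Nat.cast_pred (by simp), ← hn]
    simp
  have hcard2 : (((Finset.univ.erase (0 : Fin κ → ZMod 2)).erase u).card : ℝ) = 2 * n - 2 := by
    rw [Finset.cast_card_erase_of_mem (by simpa using hu0), hcard]
    ring
  have hL : ∑ m, Real.exp (θ * imbalance G m) =
      Real.exp (θ * n) + (Real.exp (-(θ * n)) + (2 * n - 2)) := by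
    rw [← Finset.add_sum_erase _ _ (Finset.mem_univ 0),
      ← Finset.add_sum_erase _ _ (Finset.mem_erase.2 ⟨hu0, Finset.mem_univ u⟩),
      imbalance_zero, hu, mul_neg, ← hcard2, Finset.cast_card]
    congr 2
    refine Finset.sum_congr rfl fun m hm => ?_
    simp only [Finset.mem_erase] at hm
    rw [imbalance_eq_zero hn hG hu0 hu hm.2.1 hm.1, mul_zero, Real.exp_zero]
  rw [hL, ← Finset.add_sum_erase _ _ (Finset.mem_univ 0), imbalance_zero]
  have h := Finset.sum_le_sum fun m (_ : m ∈ Finset.univ.erase (0 : Fin κ → ZMod 2)) =>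
    quadratic_le_exp_mul hθ hn' (neg_le_imbalance H m)
  rw [← hc, Finset.sum_add_distrib, Finset.sum_add_distrib, ← Finset.mul_sum, ← Finset.mul_sum,
    ← Finset.cast_card, hcard] at h
  have h1 := sum_imbalance_nonneg H
  have h2 := le_sum_imbalance_sq H
  rw [← Finset.add_sum_erase _ _ (Finset.mem_univ 0), imbalance_zero] at h1 h2
  rw [hn] at h2
  -- Over `m ≠ 0` the moments are at least `-n` and `n ^ 2`; since `θ` and `c` are nonnegative, both
  -- bounds pass to the minorant.
  have h3 := mul_le_mul_of_nonneg_left h1 hθ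
  have h4 := mul_le_mul_of_nonneg_left h2 hc0
  nlinarith

/-- Up to normalization, the weight enumerator of the dual code at `1 - ε`, by MacWilliams'
identity. -/
def dualEnumerator (G : Matrix (Fin κ) (Fin n) (ZMod 2)) (ε : ℝ) : ℝ :=
  ∑ m : Fin κ → ZMod 2, ∏ i, if (m ᵥ* G) i = 0 then 2 - ε else ε

lemma dualEnumerator_le {ε : ℝ} (hε0 : 0 ≤ ε) (hε1 : ε ≤ 1) (hn0 : 0 < n)
    (hn : (2 : ℝ) ^ κ = 2 * n) (hG : Function.Injective G.col) {u : Fin κ → ZMod 2}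
    (hu : imbalance G u = -n) (H : Matrix (Fin κ) (Fin n) (ZMod 2)) :
    dualEnumerator G ε ≤ dualEnumerator H ε := by
  have hn' : (0 : ℝ) < n := by exact_mod_cast hn0
  have hu0 : u ≠ 0 := by
    rintro rfl
    rw [imbalance_zero] at hu
    linarith
  -- At `ε = 0` the logarithm below is unavailable; there only words with `m G = 0` contribute.
  rcases hε0.eq_or_lt with rfl | hε
  · have hG0 : dualEnumerator G 0 = 2 ^ n := by
      unfold dualEnumerator
      rw [Finset.sum_eq_single 0]
      · simp
      · intro m _ hm0
        by_contra hne
        have hall : ∀ i, (m ᵥ* G) i = 0 := by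
          intro i
          by_contra hi
          exact hne (Finset.prod_eq_zero (Finset.mem_univ i) (if_neg hi))
        have hmn : imbalance G m = n := by simp [imbalance, hall, bitSign_zero]
        by_cases hmu : m = u
        · rw [hmu, hu] at hmn
          linarith
        · rw [imbalance_eq_zero hn hG hu0 hu hm0 hmu] at hmn
          linarith
      · simp
    rw [hG0]
    have := Finset.single_le_sum
      (f := fun m : Fin κ → ZMod 2 => ∏ i, if (m ᵥ* H) i = 0 then (2 : ℝ) - 0 else 0)
      (fun m _ => Finset.prod_nonneg fun i _ => by split_ifs <;> norm_num) (Finset.mem_univ 0)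
    simpa [dualEnumerator] using this
  · set α := (Real.log (2 - ε) + Real.log ε) / 2 with hα
    set θ := (Real.log (2 - ε) - Real.log ε) / 2 with hθ
    have hθ0 : 0 ≤ θ := by
      have := Real.log_le_log hε (by linarith : ε ≤ 2 - ε)
      linarith
    have key : ∀ K : Matrix (Fin κ) (Fin n) (ZMod 2),
        dualEnumerator K ε = Real.exp (n * α) * ∑ m, Real.exp (θ * imbalance K m) := by
      intro K
      rw [dualEnumerator, Finset.mul_sum]
      refine Finset.sum_congr rfl fun m _ => ?_
      have hfac : ∀ i, (if (m ᵥ* K) i = 0 then 2 - ε else ε) =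
          Real.exp (α + θ * bitSign ((m ᵥ* K) i)) := by
        intro i
        unfold bitSign
        split_ifs
        · rw [show α + θ * 1 = Real.log (2 - ε) by rw [hα, hθ]; ring, Real.exp_log (by linarith)]
        · rw [show α + θ * -1 = Real.log ε by rw [hα, hθ]; ring, Real.exp_log hε]
      simp only [hfac]
      rw [← Real.exp_sum, Finset.sum_add_distrib, ← Finset.mul_sum, ← Real.exp_add]
      simp [imbalance]
    rw [key, key]
    exact mul_le_mul_of_nonneg_left (sum_exp_imbalance_le hθ0 hn0 hn hG hu H) (Real.exp_nonneg _)

end Characters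

/-! ### Translation symmetry of the erasure channel -/

section Erasure

variable {n : ℕ} {ε : ℝ}

lemma becTransition_nonneg (hε0 : 0 ≤ ε) (hε1 : ε ≤ 1) (x : ZMod 2) (o : Option (ZMod 2)) :
    0 ≤ becTransition ε x o := by
  cases o with
  | none => exact hε0
  | some y =>
    simp only [becTransition]
    split_ifs <;> linarith

lemma sum_becTransition (x : ZMod 2) : ∑ o, becTransition ε x o = 1 := by
  simp [Fintype.sum_option, becTransition]

lemma sum_becWord (x : Fin n → ZMod 2) : ∑ z, becWord ε x z = 1 := by
  simp only [becWord]
  rw [← Fintype.prod_sum fun i o => becTransition ε (x i) o]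
  exact Finset.prod_eq_one fun i _ => sum_becTransition (x i)

/-- The observation with the same erasures as `z` and all received letters replaced by `0`. -/
def zeroReceived (z : Fin n → Option (ZMod 2)) : Fin n → Option (ZMod 2) :=
  fun i => (z i).map fun _ => 0

lemma becWord_add_of_compatible {x : Fin n → ZMod 2} {z : Fin n → Option (ZMod 2)}
    (h : ∀ i y, z i = some y → x i = y) (c : Fin n → ZMod 2) :
    becWord ε (x + c) z = becWord ε c (zeroReceived z) := by
  refine Finset.prod_congr rfl fun i _ => ?_
  have hi := h i
  unfold zeroReceived
  cases hz : z i with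
  | none => rfl
  | some y =>
    simp only [becTransition, Pi.add_apply, Option.map_some, hi y hz, left_eq_add, eq_comm]

lemma becWord_eq_zero_of_not_compatible {x : Fin n → ZMod 2} {z : Fin n → Option (ZMod 2)}
    (h : ¬ ∀ i y, z i = some y → x i = y) : becWord ε x z = 0 := by
  push Not at h
  obtain ⟨i, y, hz, hxy⟩ := h
  refine Finset.prod_eq_zero (Finset.mem_univ i) ?_
  rw [hz]
  exact if_neg hxy.symm

/-- Both received letters become `0`, so a zero bit contributes `ε + 2 (1 - ε)`. -/
lemma sum_becWord_zeroReceived (c : Fin n → ZMod 2) :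
    ∑ z, becWord ε c (zeroReceived z) = ∏ i, if c i = 0 then 2 - ε else ε := by
  simp only [becWord, zeroReceived]
  rw [← Fintype.prod_sum fun i (o : Option (ZMod 2)) =>
    becTransition ε (c i) (o.map fun _ => 0)]
  refine Finset.prod_congr rfl fun i _ => ?_
  simp only [Fintype.sum_option, Option.map_none, Option.map_some, becTransition,
    Finset.sum_const, Finset.card_univ, ZMod.card, eq_comm (a := (0 : ZMod 2))]
  split_ifs
  · simp
    ring
  · simp

end Erasure

/-! ### Leakage and decoding in terms of peak likelihoods -/

namespace CosetCode

variable {k κ : ℕ} (C : CosetCode k κ) {ε : ℝ}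

lemma codeword_add (m : Fin k → ZMod 2) (m' m'' : Fin κ → ZMod 2) :
    C.codeword m (m' + m'') = C.codeword m m' + m'' ᵥ* C.G := by
  simp only [codeword, Matrix.sumElim_vecMul_fromRows, Matrix.add_vecMul, add_assoc]

lemma codeword_zero (m' : Fin κ → ZMod 2) : C.codeword 0 m' = m' ᵥ* C.G := by
  simp [codeword]

lemma exists_codeword_eq (x : Fin (k + κ) → ZMod 2) : ∃ m m', C.codeword m m' = x := by
  have hspan := C.linearIndependent_rows.span_eq_top_of_card_eq_finrank' (by simp)
  have hx : x ∈ Submodule.span (ZMod 2) (Set.range (Matrix.fromRows C.G' C.G).row) := by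
    rw [hspan]; trivial
  obtain ⟨w, hw⟩ := (Submodule.mem_span_range_iff_exists_fun _).1 hx
  refine ⟨w ∘ Sum.inl, w ∘ Sum.inr, ?_⟩
  rw [codeword, Sum.elim_comp_inl_inr, Matrix.vecMul_eq_sum, ← hw]
  rfl

/-- The largest likelihood of a message given the observation `z`. -/
noncomputable def peakLikelihood (ε : ℝ) (z : Fin (k + κ) → Option (ZMod 2)) : ℝ :=
  C.likelihood ε 0 (zeroReceived z)

lemma likelihood_eq_zero_or_peak (m : Fin k → ZMod 2) (z : Fin (k + κ) → Option (ZMod 2)) :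
    C.likelihood ε m z = 0 ∨ C.likelihood ε m z = C.peakLikelihood ε z := by
  by_cases h : ∃ m', ∀ i y, z i = some y → C.codeword m m' i = y
  · obtain ⟨m', hm'⟩ := h
    right
    simp only [peakLikelihood, likelihood]
    rw [← Equiv.sum_comp (Equiv.addLeft m')]
    refine Finset.sum_congr rfl fun m'' _ => ?_
    rw [Equiv.coe_addLeft, codeword_add, becWord_add_of_compatible hm', codeword_zero]
  · left
    refine Finset.sum_eq_zero fun m' _ => ?_
    rw [becWord_eq_zero_of_not_compatible fun hm' => h ⟨m', hm'⟩, mul_zero]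

lemma exists_likelihood_eq_peak (z : Fin (k + κ) → Option (ZMod 2)) :
    ∃ m, C.likelihood ε m z = C.peakLikelihood ε z := by
  -- Any filling of the erasures is a codeword, as the stacked rows span the whole space.
  obtain ⟨m, m', hm⟩ := C.exists_codeword_eq fun i => (z i).getD 0
  refine ⟨m, ?_⟩
  have hm' : ∀ i y, z i = some y → C.codeword m m' i = y := fun i y hz => by
    simp only [hm, hz, Option.getD_some]
  simp only [peakLikelihood, likelihood]
  rw [← Equiv.sum_comp (Equiv.addLeft m')]
  refine Finset.sum_congr rfl fun m'' _ => ?_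
  rw [Equiv.coe_addLeft, codeword_add, becWord_add_of_compatible hm', codeword_zero]

lemma likelihood_nonneg (hε0 : 0 ≤ ε) (hε1 : ε ≤ 1) (m : Fin k → ZMod 2)
    (z : Fin (k + κ) → Option (ZMod 2)) : 0 ≤ C.likelihood ε m z :=
  Finset.sum_nonneg fun _ _ => mul_nonneg (by positivity)
    (Finset.prod_nonneg fun _ _ => becTransition_nonneg hε0 hε1 _ _)

lemma sum_peakLikelihood :
    ∑ z, C.peakLikelihood ε z = 1 / 2 ^ κ * dualEnumerator C.G ε := by
  simp only [peakLikelihood, likelihood, codeword_zero]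
  rw [Finset.sum_comm, dualEnumerator, Finset.mul_sum]
  refine Finset.sum_congr rfl fun m' _ => ?_
  rw [← Finset.mul_sum, sum_becWord_zeroReceived]

lemma sum_likelihood (m : Fin k → ZMod 2) : ∑ z, C.likelihood ε m z = 1 := by
  simp only [likelihood]
  rw [Finset.sum_comm]
  simp [← Finset.mul_sum, sum_becWord]

lemma sum_pZ : ∑ z, C.pZ ε z = 1 := by
  simp only [pZ, pMZ, pM]
  rw [Finset.sum_comm]
  simp [← Finset.mul_sum, sum_likelihood]

lemma successProbability_eq (hε0 : 0 ≤ ε) (hε1 : ε ≤ 1)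
    {g : (Fin (k + κ) → Option (ZMod 2)) → Fin k → ZMod 2} (hg : C.IsMLDecoder ε g) :
    C.successProbability ε g = 1 / 2 ^ k * ∑ z, C.peakLikelihood ε z := by
  rw [successProbability, Finset.mul_sum]
  refine Finset.sum_congr rfl fun z _ => ?_
  rw [pMZ, pM]
  congr 1
  obtain ⟨m, hm⟩ := C.exists_likelihood_eq_peak (ε := ε) z
  rcases C.likelihood_eq_zero_or_peak (ε := ε) (g z) z with h | h
  -- A maximizer of likelihood zero forces the peak to be zero.
  · have h1 := hg z m
    have h2 := C.likelihood_nonneg hε0 hε1 m z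
    linarith
  · exact h

/-- The contribution of a single observation to the `χ²` divergence, for likelihoods that take
only one nonzero value `c`. -/
lemma sum_chiSquared_terms {α : Type*} [Fintype α] [Nonempty α] {L : α → ℝ} {c : ℝ}
    (hL : ∀ a, L a = 0 ∨ L a = c) (hc : ∃ a, L a = c) {p : ℝ} (hp : p ≠ 0)
    (hcard : p * Fintype.card α = 1) :
    ∑ a, (p * L a / (p * ∑ b, p * L b) - 1) ^ 2 * (p * ∑ b, p * L b) =
      c - ∑ b, p * L b := by
  rw [← Finset.mul_sum]
  set s := ∑ b, L b with hs
  have hsq : ∑ a, L a ^ 2 = c * s := by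
    rw [hs, Finset.mul_sum]
    refine Finset.sum_congr rfl fun a _ => ?_
    rcases hL a with h | h <;> rw [h] <;> ring
  -- Covers the convention `x / 0 = 0`: both sides then vanish.
  have hs0 : s = 0 → c = 0 := by
    intro h
    by_contra hc0
    obtain ⟨a, ha⟩ := hc
    rw [h, mul_zero] at hsq
    rw [Finset.sum_eq_zero_iff_of_nonneg fun _ _ => sq_nonneg _] at hsq
    have := hsq a (Finset.mem_univ a)
    rw [ha] at this
    exact hc0 (pow_eq_zero_iff two_ne_zero |>.1 this)
  by_cases h : s = 0
  · simp [h, hs0 h]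
  · have hterm : ∀ a, (p * L a / (p * (p * s)) - 1) ^ 2 * (p * (p * s)) =
        L a ^ 2 * s⁻¹ - 2 * p * L a + p * (p * s) := by
      intro a
      field_simp
      ring
    simp only [hterm]
    rw [Finset.sum_add_distrib, Finset.sum_sub_distrib, ← Finset.sum_mul, ← Finset.mul_sum, hsq,
      mul_inv_cancel_right₀ h, ← hs, Finset.sum_const, Finset.card_univ, nsmul_eq_mul]
    linear_combination p * s * hcard

lemma chiSquaredLeakage_eq :
    C.chiSquaredLeakage ε = ∑ z, C.peakLikelihood ε z - 1 := by
  rw [chiSquaredLeakage, chiSquared, Fintype.sum_prod_type, Finset.sum_comm]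
  conv_rhs => rw [← C.sum_pZ (ε := ε), ← Finset.sum_sub_distrib]
  refine Finset.sum_congr rfl fun z _ => ?_
  have h := sum_chiSquared_terms (L := fun m => C.likelihood ε m z)
    (fun m => C.likelihood_eq_zero_or_peak m z) (C.exists_likelihood_eq_peak z)
    (p := 1 / 2 ^ k) (by positivity) (by simp)
  simpa only [pZ, pMZ, pM] using h

variable {C}

lemma IsAugmentedHadamard.two_pow_eq (hC : C.IsAugmentedHadamard) :
    (2 : ℝ) ^ κ = 2 * ((k + κ : ℕ) : ℝ) := by
  obtain ⟨hn, U, hU, -⟩ := hC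
  obtain ⟨d, rfl⟩ : ∃ d, κ = d + 1 := ⟨_, hU.symm⟩
  rw [hn]
  rw [Nat.add_sub_cancel]
  push_cast
  ring

lemma IsAugmentedHadamard.columns_distinct_notMem (hC : C.IsAugmentedHadamard) :
    ∃ U : Submodule (ZMod 2) (Fin κ → ZMod 2), Module.finrank (ZMod 2) U + 1 = κ ∧
      (∀ j, C.G.col j ∉ U) ∧ Function.Injective C.G.col := by
  have h2 := hC.two_pow_eq
  obtain ⟨hn, U, hU, hq⟩ := hC
  have hn0 : (0 : ℝ) < ((k + κ : ℕ) : ℝ) := by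
    have : (0 : ℝ) < 2 ^ κ := by positivity
    linarith
  have hcount : ∀ j, C.G.col j ∉ U ∧
      (Finset.univ.filter fun i => C.G.col i = C.G.col j).card = 1 := by
    intro j
    have hj := congrFun hq (C.G.col j)
    have hmem : j ∈ Finset.univ.filter fun i => C.G.col i = C.G.col j := by simp
    have hpos : (0 : ℝ) < (Finset.univ.filter fun i => C.G.col i = C.G.col j).card := by
      exact_mod_cast Finset.card_pos.2 ⟨j, hmem⟩
    simp only [codeDefinitionVector, subspaceExclusionVector] at hj
    split_ifs at hj with hjU
    · exact absurd hj (div_pos hpos hn0).ne'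
    · refine ⟨hjU, ?_⟩
      -- As many vectors lie outside `U` as there are columns, so each multiplicity is one.
      have hd : (2 : ℝ) ^ κ - 2 ^ Module.finrank (ZMod 2) U = ((k + κ : ℕ) : ℝ) := by
        have : (2 : ℝ) ^ κ = 2 ^ Module.finrank (ZMod 2) U * 2 := by rw [← pow_succ, hU]
        linarith
      rw [hd, div_left_inj' hn0.ne'] at hj
      exact_mod_cast hj
  refine ⟨U, hU, fun j => (hcount j).1, fun i j hij => ?_⟩
  exact Finset.card_le_one.1 (hcount j).2.le i (by simpa using hij) j (by simp)

/-- The hyperplane `U` is the kernel of a functional, which is nonzero on every column; its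
coordinate vector `u` encodes to the all-ones word. -/
lemma IsAugmentedHadamard.exists_imbalance_eq (hC : C.IsAugmentedHadamard) :
    ∃ u, imbalance C.G u = -((k + κ : ℕ) : ℝ) := by
  obtain ⟨U, hU, hcol, -⟩ := hC.columns_distinct_notMem
  have hlt : U < ⊤ := by
    rw [lt_top_iff_ne_top]
    rintro rfl
    simp at hU
  obtain ⟨f, hf0, hf⟩ := Submodule.exists_le_ker_of_lt_top U hlt
  have hker : U = LinearMap.ker f := by
    refine Submodule.eq_of_le_of_finrank_le hf ?_
    have h := f.finrank_range_add_finrank_ker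
    rw [LinearMap.range_eq_top.2 (LinearMap.surjective hf0)] at h
    simp at h
    omega
  refine ⟨fun i => f (Pi.single i 1), ?_⟩
  have hdot : ∀ j, ((fun i => f (Pi.single i 1)) ᵥ* C.G) j = f (C.G.col j) := by
    intro j
    rw [LinearMap.pi_apply_eq_sum_univ f (C.G.col j)]
    simp only [Matrix.vecMul, dotProduct, smul_eq_mul, Matrix.col_apply, mul_comm]
    refine Finset.sum_congr rfl fun i _ => ?_
    congr 2
    ext l
    simp [Pi.single_apply, eq_comm]
  have hne : ∀ j, f (C.G.col j) ≠ 0 := fun j h => hcol j (hker ▸ LinearMap.mem_ker.2 h)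
  simp only [imbalance, hdot, bitSign, hne, if_false]
  simp

end CosetCode

theorem corollary4 (k κ : ℕ) (C : CosetCode k κ) (hC : C.IsAugmentedHadamard)
    (D : CosetCode k κ) (ε : ℝ) (hε0 : 0 ≤ ε) (hε1 : ε ≤ 1) :
    C.chiSquaredLeakage ε ≤ D.chiSquaredLeakage ε ∧
      ∀ g h : (Fin (k + κ) → Option (ZMod 2)) → Fin k → ZMod 2,
        C.IsMLDecoder ε g → D.IsMLDecoder ε h →
          C.successProbability ε g ≤ D.successProbability ε h := by
  obtain ⟨-, -, -, hG⟩ := hC.columns_distinct_notMem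
  obtain ⟨u, hu⟩ := hC.exists_imbalance_eq
  have hpeak : ∑ z, C.peakLikelihood ε z ≤ ∑ z, D.peakLikelihood ε z := by
    rw [C.sum_peakLikelihood, D.sum_peakLikelihood]
    refine mul_le_mul_of_nonneg_left ?_ (by positivity)
    exact dualEnumerator_le hε0 hε1 (hC.1 ▸ by positivity) hC.two_pow_eq hG hu D.G
  refine ⟨?_, fun g h hg hh => ?_⟩
  · rw [C.chiSquaredLeakage_eq, D.chiSquaredLeakage_eq]
    linarith
  · rw [C.successProbability_eq hε0 hε1 hg, D.successProbability_eq hε0 hε1 hh]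
    exact mul_le_mul_of_nonneg_left hpeak (by positivity)
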